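/- Let $-\pi<a<b<\pi$, and put $I=[a,b]$, $E^-=[-\pi,a]$, $E^+=[b,\pi]$, $E=E^-\cup E^+$. For a compact set $S\subset\mathbb R$ let $PW_S$ be the space of entire functions $f(z)=\int_S g(t)e^{izt}\,dt$ with $g\in L^2(S)$, with norm $\|f\|^2=\frac1{2\pi}\int_{\mathbb R}|f(x)|^2\,dx$ and reproducing kernels $k^S_w(z)=\int_S e^{i(z-\bar w)t}\,dt$, $w\in\mathbb C$; write $PW_\pi=PW_{[-\pi,\pi]}$ and $k^\pi_w=k^{[-\pi,\pi]}_w$. A set $\Lambda\subset\mathbb C$ is called a complete interpolating sequence for $PW_S$ if for every $(a_\lambda)_{\lambda\in\Lambda}\in\ell^2(\Lambda)$ there is a unique $f\in PW_S$ with $f(\lambda)/\|k^S_\lambda\|=a_\lambda$ for all $\lambda\in\Lambda$. Let $\Lambda\subset\mathbb C$ and let $F\in PW_E+zPW_E$ satisfy $F(\lambda)=0$ for all $\lambda\in\Lambda$. Let $T$ be the set of zeros of $F$ that do not belong to $\Lambda$, and let $F=F^-+F^+$ be the decomposition with $F^\pm\in PW_{E^\pm}+zPW_{E^\pm}$. Suppose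 that (i) $\Lambda\cup T$ is a complete interpolating sequence for $PW_\pi$; (ii) $T$ is a complete interpolating sequence for $PW_I$; (iii) $\displaystyle\inf_{t\in T}\left|\frac{F^+(t)}{F'(t)}\right|\,\|k^\pi_t\|\,\|k^I_{\bar t}\|>0$. Then $\Lambda$ is a complete interpolating sequence for $PW_E$. -/

import Mathlib

open MeasureTheory

noncomputable section

/-- The Paley-Wiener space of a compact set `S` of frequencies, as a space of entire functions:
the functions `f(z) = ∫_S g(t) e^{izt} dt` with `g ∈ L²(S)`. This is the image of `L²(S)` under
the inverse of the Fourier transform `f ↦ (2π)⁻¹ ∫ f(x) e^{-ixt} dx`. -/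
def PaleyWiener (S : Set ℝ) : Set (ℂ → ℂ) :=
  {f | ∃ g : ℝ → ℂ, MemLp g 2 (volume.restrict S) ∧
    ∀ z : ℂ, f z = ∫ t in S, g t * Complex.exp (Complex.I * z * t)}

/-- The norm of the Paley-Wiener space, i.e. the norm of `L²(ℝ, dx / 2π)` applied to the
restriction of `f` to the real line. -/
def pwNorm (f : ℂ → ℂ) : ℝ :=
  Real.sqrt ((2 * Real.pi)⁻¹ * ∫ x : ℝ, ‖f (x : ℂ)‖ ^ 2)

/-- The reproducing kernel `k^S_w(z) = ∫_S e^{i (z - conj w) t} dt` of the Paley-Wiener space. -/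
def pwKernel (S : Set ℝ) (w : ℂ) : ℂ → ℂ := fun z =>
  ∫ t in S, Complex.exp (Complex.I * (z - (starRingEnd ℂ) w) * t)

/-- `L` is a complete interpolating sequence for the Paley-Wiener space of `S`: for all
square-summable data `a` on `L` the problem `f(l) / ‖k^S_l‖ = a l` for `l ∈ L` has a unique
solution `f` in the Paley-Wiener space. -/
def IsCompleteInterpolating (S : Set ℝ) (L : Set ℂ) : Prop :=
  ∀ a : L → ℂ, Summable (fun l => ‖a l‖ ^ 2) →
    ∃! f : ℂ → ℂ, f ∈ PaleyWiener S ∧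
      ∀ l : L, f (l : ℂ) / ((pwNorm (pwKernel S (l : ℂ)) : ℝ) : ℂ) = a l

/-- The space `PW_S + z PW_S`. -/
def PaleyWienerExt (S : Set ℝ) : Set (ℂ → ℂ) :=
  {F | ∃ f ∈ PaleyWiener S, ∃ g ∈ PaleyWiener S, ∀ z : ℂ, F z = f z + z * g z}

/-- `F` is a generating function for `L` in the Paley-Wiener space of `S`. -/
def IsGeneratingFunction (S : Set ℝ) (L : Set ℂ) (F : ℂ → ℂ) : Prop :=
  F ∈ PaleyWienerExt S ∧ ∀ l ∈ L, F l = 0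

/-- The zeros of `F` other than the points of `L`. -/
def otherZeros (F : ℂ → ℂ) (L : Set ℂ) : Set ℂ := {z | F z = 0 ∧ z ∉ L}

end

/-! Plancherel identifies `PW_S` with `L²(S)`, evaluation at `w` becoming the inner product with an
exponential. Complete interpolation thus says that moment problems against normalized exponentials
are uniquely solvable (`isCompleteInterpolating_iff`), and `PW_E` is the kernel of the restriction
`P : L²[-π,π] → L²(I)` (`mem_paleyWiener_union_iff`).

For `t ∈ T` the dual vector `u_t` of the system on `Λ ∪ T` is `F(z)/((z-t)F'(t))` up to
normalization. Since `F` has no spectrum inside the gap, dividing by `z - t` produces there a pure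
exponential with coefficient `i F⁺(t)`. Hence `P u_t = γ_t κ_t` with `κ_t` the unit kernel of `PW_I`
at `conj t`, and `|γ_t|` is the quantity in (iii) (`exists_dual_of_zero`). By reflection (ii) also
holds for the conjugates of `T`, so `κ` is interpolating.

Let `R` map `c ∈ ℓ²(T)` to the function with data `0` on `Λ` and `c` on `T`. It is bounded by the
closed graph theorem, and `P R` sends unit vectors to `γ_t κ_t`, so it is bijective. Surjectivity
allows any solution on `Λ` to be corrected into `ker P`. Injectivity gives uniqueness, provided the
values on `T` of a function in `PW_π` are square-summable after normalization; this Bessel property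
is carried from `I` to `[-π,π]` by translates of `I` (`existsUnique_ker_of_dual_system`,
`summable_inner_unitKernel_of_subinterval`). -/

noncomputable section

open scoped InnerProductSpace lp ENNReal FourierTransform

/-! ### Interpolating systems in Hilbert space -/

section Systems

variable {H V E : Type*} [NormedAddCommGroup H] [InnerProductSpace ℂ H] [CompleteSpace H]
  [NormedAddCommGroup V] [InnerProductSpace ℂ V] [CompleteSpace V]
  [NormedAddCommGroup E] [NormedSpace ℂ E] [CompleteSpace E]

/-- A system of vectors for which every square-summable moment problem has a unique solution. -/
def IsInterpolatingSystem {ι : Type*} (k : ι → H) : Prop :=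
  ∀ a : ι → ℂ, Summable (fun i => ‖a i‖ ^ 2) → ∃! u : H, ∀ i, ⟪k i, u⟫_ℂ = a i

theorem memlp_two_iff_summable {ι : Type*} (a : ι → ℂ) :
    Memℓp a 2 ↔ Summable (fun i => ‖a i‖ ^ 2) := by
  rw [memℓp_gen_iff (by norm_num)]
  simp

/-- Uniquely solvable moment problems with continuous data are solved by a bounded operator. -/
theorem exists_clm_of_existsUnique_inner {ι : Type*} (k : ι → H) (ψ : ι → E →L[ℂ] ℂ)
    (h : ∀ x, ∃! u : H, ∀ i, ⟪k i, u⟫_ℂ = ψ i x) :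
    ∃ R : E →L[ℂ] H, ∀ x i, ⟪k i, R x⟫_ℂ = ψ i x := by
  choose r hr huniq using h
  let R : E →ₗ[ℂ] H :=
    { toFun := r
      map_add' := fun x y => by
        refine (huniq (x + y) _ fun i => ?_).symm
        rw [inner_add_right, hr, hr, map_add]
      map_smul' := fun c x => by
        refine (huniq (c • x) _ fun i => ?_).symm
        simp only [RingHom.id_apply]
        rw [inner_smul_right, hr, map_smul, smul_eq_mul] }
  -- Closed graph: the moments of a limit are the limits of the moments, and uniqueness identifies
  -- the limit.
  refine ⟨ContinuousLinearMap.ofSeqClosedGraph (g := R) fun u x y hu hy => ?_, fun x i => hr x i⟩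
  refine huniq x y fun i => ?_
  have h1 : Filter.Tendsto (fun n => ⟪k i, R (u n)⟫_ℂ) Filter.atTop (nhds ⟪k i, y⟫_ℂ) :=
    ((innerSL ℂ (k i)).continuous.tendsto y).comp hy
  have h2 : Filter.Tendsto (fun n => ψ i (u n)) Filter.atTop (nhds (ψ i x)) :=
    ((ψ i).continuous.tendsto x).comp hu
  have h3 : (fun n => ⟪k i, R (u n)⟫_ℂ) = fun n => ψ i (u n) := funext fun n => hr (u n) i
  rw [h3] at h1
  exact tendsto_nhds_unique h1 h2

open Classical in
/-- A bounded operator sending the unit vectors of `ℓ²` to multiples of an interpolating system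
that are bounded below is bijective. -/
theorem bijective_of_map_single_eq_smul {τ : Type*} {κ : τ → V} (hκ : IsInterpolatingSystem κ)
    (Q : ℓ²(τ, ℂ) →L[ℂ] V) (γ : τ → ℂ) {δ : ℝ} (hδ : 0 < δ) (hγ : ∀ t, δ ≤ ‖γ t‖)
    (hQ : ∀ t, Q (lp.single 2 t 1) = γ t • κ t) : Function.Bijective Q := by
  have hγ0 : ∀ t, γ t ≠ 0 := fun t h => by
    have := hγ t; rw [h, norm_zero] at this; linarith
  have hadj : ∀ x t, (Q.adjoint x : τ → ℂ) t = (starRingEnd ℂ) (γ t) * ⟪κ t, x⟫_ℂ := fun x t => by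
    have h1 := lp.inner_single_left (𝕜 := ℂ) t (1 : ℂ) (Q.adjoint x)
    rw [ContinuousLinearMap.adjoint_inner_right, hQ, inner_smul_left] at h1
    rw [h1]; simp
  -- Inverting the adjoint is the moment problem for `κ` with data `b t / conj (γ t)`,
  -- square-summable because `γ` is bounded below.
  have hbij : Function.Bijective Q.adjoint := by
    have key : ∀ b : ℓ²(τ, ℂ), ∃! x, ∀ t, ⟪κ t, x⟫_ℂ = b t / (starRingEnd ℂ) (γ t) := fun b => by
      refine hκ _ (Summable.of_nonneg_of_le (fun _ => by positivity) (fun t => ?_)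
        (((memlp_two_iff_summable _).1 (lp.memℓp b)).mul_left ((δ ^ 2)⁻¹)))
      rw [norm_div, RCLike.norm_conj, div_pow, div_eq_inv_mul]
      gcongr
      exact hγ t
    have hiff : ∀ (b : ℓ²(τ, ℂ)) x,
        (∀ t, ⟪κ t, x⟫_ℂ = b t / (starRingEnd ℂ) (γ t)) ↔ Q.adjoint x = b := fun b x => by
      constructor
      · intro h
        ext t
        rw [hadj, h, mul_div_cancel₀ _ (by simpa using hγ0 t)]
      · rintro rfl t
        rw [hadj, mul_div_cancel_left₀ _ (by simpa using hγ0 t)]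
    refine Function.bijective_iff_existsUnique _ |>.2 fun b => ?_
    simpa only [hiff] using key b
  let e := ContinuousLinearEquiv.ofBijective Q.adjoint
    (LinearMap.ker_eq_bot.2 hbij.1) (LinearMap.range_eq_top.2 hbij.2)
  have he : (e : V →L[ℂ] ℓ²(τ, ℂ)) = Q.adjoint := rfl
  -- The adjoint of the inverse of `Q.adjoint` is a two-sided inverse of `Q`.
  have h1 : Q ∘L (e.symm : ℓ²(τ, ℂ) →L[ℂ] V).adjoint = ContinuousLinearMap.id ℂ V := by
    have : Q = (Q.adjoint).adjoint := (ContinuousLinearMap.adjoint_adjoint Q).symm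
    rw [this, ← he, ← ContinuousLinearMap.adjoint_comp]
    simp [ContinuousLinearMap.adjoint_id]
  have h2 : (e.symm : ℓ²(τ, ℂ) →L[ℂ] V).adjoint ∘L Q = ContinuousLinearMap.id ℂ _ := by
    have : Q = (Q.adjoint).adjoint := (ContinuousLinearMap.adjoint_adjoint Q).symm
    rw [this, ← he, ← ContinuousLinearMap.adjoint_comp]
    simp [ContinuousLinearMap.adjoint_id]
  exact Function.bijective_iff_has_inverse.2
    ⟨_, fun x => DFunLike.congr_fun h2 x, fun x => DFunLike.congr_fun h1 x⟩

open Classical in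
/-- If the dual vectors of the `T`-part of an interpolating system are mapped by `P` to multiples,
bounded below, of an interpolating system, then the remaining part is interpolating on `ker P`. -/
theorem existsUnique_ker_of_dual_system {ι τ : Type*} {k : ι → H} {l : τ → H} {κ : τ → V}
    (hkl : IsInterpolatingSystem (Sum.elim k l)) (hκ : IsInterpolatingSystem κ) (P : H →L[ℂ] V)
    (γ : τ → ℂ) {δ : ℝ} (hδ : 0 < δ) (hγ : ∀ t, δ ≤ ‖γ t‖)
    (hP : ∀ t, ∃ u : H, (∀ i, ⟪k i, u⟫_ℂ = 0) ∧ (∀ s, ⟪l s, u⟫_ℂ = if s = t then 1 else 0) ∧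
      P u = γ t • κ t)
    (hbessel : (∀ x : V, Summable fun t => ‖⟪κ t, x⟫_ℂ‖ ^ 2) →
      ∀ u : H, Summable fun t => ‖⟪l t, u⟫_ℂ‖ ^ 2)
    (a : ι → ℂ) (ha : Summable fun i => ‖a i‖ ^ 2) :
    ∃! u : H, P u = 0 ∧ ∀ i, ⟪k i, u⟫_ℂ = a i := by
  have hinj : ∀ {u v : H}, (∀ i, ⟪k i, u⟫_ℂ = ⟪k i, v⟫_ℂ) → (∀ s, ⟪l s, u⟫_ℂ = ⟪l s, v⟫_ℂ) →
      u = v := fun {u v} h1 h2 => by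
    obtain ⟨w, -, hw⟩ := hkl (fun _ => 0) (by simp)
    refine sub_eq_zero.1 ((hw (u - v) ?_).trans (hw 0 fun i => inner_zero_right _).symm)
    rintro (i | s)
    · rw [inner_sub_right]; simp [h1]
    · rw [inner_sub_right]; simp [h2]
  obtain ⟨R, hR⟩ := exists_clm_of_existsUnique_inner (E := ℓ²(τ, ℂ)) (Sum.elim k l)
    (Sum.elim (fun _ => 0) fun t => lp.evalCLM ℂ (fun _ : τ => ℂ) 2 t) fun c => by
      refine hkl (fun z => (Sum.elim (fun _ => 0) fun t => lp.evalCLM ℂ (fun _ : τ => ℂ) 2 t :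
        ι ⊕ τ → ℓ²(τ, ℂ) →L[ℂ] ℂ) z c) ?_
      rw [← Sum.inr_injective.summable_iff]
      · exact (memlp_two_iff_summable _).1 (lp.memℓp c)
      · rintro (i | t) h
        · simp
        · exact absurd ⟨t, rfl⟩ h
  have hRk : ∀ c i, ⟪k i, R c⟫_ℂ = 0 := fun c i => hR c (Sum.inl i)
  have hRl : ∀ (c : ℓ²(τ, ℂ)) t, ⟪l t, R c⟫_ℂ = c t := fun c t => hR c (Sum.inr t)
  have hQ : ∀ t, (P ∘L R) (lp.single 2 t 1) = γ t • κ t := fun t => by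
    obtain ⟨u, h1, h2, h3⟩ := hP t
    rw [← h3, ContinuousLinearMap.comp_apply, hinj (u := R _) (v := u)]
    · intro i; rw [hRk, h1]
    · intro s
      rw [hRl, h2, lp.single_apply, Pi.single_apply]
  have hbij := bijective_of_map_single_eq_smul hκ (P ∘L R) γ hδ hγ hQ
  -- The adjoint of `P ∘L R` takes values in `ℓ²`; dividing its coordinates by `conj (γ t)` gives
  -- the Bessel property of `κ`.
  have hB := hbessel fun x => by
    have hγ0 : ∀ t, γ t ≠ 0 := fun t h => by
      have := hγ t; rw [h, norm_zero] at this; linarith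
    have hadj : ∀ t, ((P ∘L R).adjoint x : τ → ℂ) t = (starRingEnd ℂ) (γ t) * ⟪κ t, x⟫_ℂ :=
      fun t => by
        have h1 := lp.inner_single_left (𝕜 := ℂ) t (1 : ℂ) ((P ∘L R).adjoint x)
        rw [ContinuousLinearMap.adjoint_inner_right, hQ, inner_smul_left] at h1
        rw [h1]; simp
    refine Summable.of_nonneg_of_le (fun _ => by positivity) (fun t => ?_)
      (((memlp_two_iff_summable _).1 (lp.memℓp ((P ∘L R).adjoint x))).mul_left ((δ ^ 2)⁻¹))
    rw [hadj, norm_mul, RCLike.norm_conj, mul_pow, ← mul_assoc, ← div_eq_inv_mul]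
    refine le_mul_of_one_le_left (by positivity) ((one_le_div (by positivity)).2 ?_)
    gcongr
    exact hγ t
  have hex : ∃ u : H, P u = 0 ∧ ∀ i, ⟪k i, u⟫_ℂ = a i := by
    obtain ⟨u, hu, -⟩ := hkl (Sum.elim a fun _ => 0) <| by
      rw [← Sum.inl_injective.summable_iff]
      · exact ha
      · rintro (i | t) h
        · exact absurd ⟨i, rfl⟩ h
        · simp
    -- Adding `R c` cancels `P u` without disturbing the moments against `k`.
    obtain ⟨c, hc⟩ := hbij.2 (-P u)
    refine ⟨u + R c, ?_, fun i => ?_⟩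
    · rw [map_add, ← ContinuousLinearMap.comp_apply P R, hc, add_neg_cancel]
    · rw [inner_add_right, hRk, add_zero]
      exact hu (Sum.inl i)
  obtain ⟨u, hu⟩ := hex
  refine ⟨u, hu, fun v hv => ?_⟩
  -- The Bessel property is what puts the difference of two solutions in the range of `R`.
  let c : ℓ²(τ, ℂ) := ⟨fun t => ⟪l t, v - u⟫_ℂ, (memlp_two_iff_summable _).2 (hB (v - u))⟩
  have hc : v - u = R c := by
    refine hinj (fun i => ?_) fun s => ?_
    · rw [hRk, inner_sub_right, hv.2, hu.2, sub_self]
    · rw [hRl]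
  have h0 : (P ∘L R) c = (P ∘L R) 0 := by
    rw [map_zero, ContinuousLinearMap.comp_apply, ← hc, map_sub, hv.1, hu.1, sub_self]
  rw [← sub_eq_zero, hc, hbij.1 h0, map_zero]

end Systems

/-! ### Plancherel's theorem for the Fourier integral -/

section Plancherel

/-- On `L¹ ∩ L²` the Fourier transform of `L²` is given by the Fourier integral. -/
theorem coeFn_fourier_toLp_ae_eq {f : ℝ → ℂ} (h1 : Integrable f) (h2 : MemLp f 2) :
    (𝓕 (h2.toLp f) : Lp ℂ 2 (volume : Measure ℝ)) =ᵐ[volume] 𝓕 f := by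
  have hcont : Continuous (𝓕 f) := VectorFourier.fourierIntegral_continuous
    Real.continuous_fourierChar (by exact continuous_inner) h1
  refine ae_eq_of_integral_contDiff_smul_eq ((Lp.memLp _).locallyIntegrable (by norm_num))
    hcont.locallyIntegrable fun g hg hgs => ?_
  have hg₁ : HasCompactSupport (Complex.ofRealCLM ∘ g) := hgs.comp_left rfl
  have hg₂ : ContDiff ℝ ((⊤ : ℕ∞) : WithTop ℕ∞) (Complex.ofRealCLM ∘ g) :=
    Complex.ofRealCLM.contDiff.comp hg
  let φ := hg₁.toSchwartzMap hg₂
  have hφ : ∀ x, φ x = (g x : ℂ) := fun x => rfl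
  -- Both functions agree as distributions: the `L²` transform by its compatibility with tempered
  -- distributions, the integral by Fubini (`h4`).
  have key := congrArg (fun T => T φ) (Lp.fourier_toTemperedDistribution_eq (h2.toLp f))
  simp only [TemperedDistribution.fourier_apply, Lp.toTemperedDistribution_apply] at key
  have h3 : ∫ x, (𝓕 φ) x • (h2.toLp f) x = ∫ x, 𝓕 (φ : ℝ → ℂ) x • f x := by
    refine integral_congr_ae ?_
    filter_upwards [h2.coeFn_toLp] with x hx
    rw [hx, SchwartzMap.fourier_coe]
  have h4 : ∫ x, 𝓕 (φ : ℝ → ℂ) x • f x = ∫ x, φ x • 𝓕 f x := by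
    have := VectorFourier.integral_fourierIntegral_smul_eq_flip (L := innerₗ ℝ)
      Real.continuous_fourierChar continuous_inner (φ.integrable (μ := volume)) h1
    rw [flip_innerₗ] at this
    exact this
  rw [h3, h4] at key
  simp only [hφ] at key
  simpa [Complex.real_smul] using key.symm

theorem integral_norm_fourier_sq {f : ℝ → ℂ} (h1 : Integrable f) (h2 : MemLp f 2) :
    ∫ x, ‖𝓕 f x‖ ^ 2 = ∫ x, ‖f x‖ ^ 2 := by
  have key : ∀ u : Lp ℂ 2 (volume : Measure ℝ), ∫ x, ‖u x‖ ^ 2 = ‖u‖ ^ 2 := fun u => by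
    have := L2.inner_def (𝕜 := ℂ) u u
    simp only [inner_self_eq_norm_sq_to_K] at this
    norm_cast at this
    simpa [integral_ofReal] using this.symm
  calc ∫ x, ‖𝓕 f x‖ ^ 2 = ∫ x, ‖(𝓕 (h2.toLp f) : Lp ℂ 2 (volume : Measure ℝ)) x‖ ^ 2 := by
        refine integral_congr_ae ?_
        filter_upwards [coeFn_fourier_toLp_ae_eq h1 h2] with x hx
        rw [hx]
    _ = ∫ x, ‖(h2.toLp f) x‖ ^ 2 := by rw [key, key, Lp.norm_fourier_eq]
    _ = ∫ x, ‖f x‖ ^ 2 := by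
        refine integral_congr_ae ?_
        filter_upwards [h2.coeFn_toLp] with x hx
        rw [hx]

end Plancherel

/-! ### Paley-Wiener functions and their spectral functions -/

section Transform

variable {S : Set ℝ}

theorem MeasureTheory.MemLp.integrable_of_isCompact (hS : IsCompact S) {g : ℝ → ℂ}
    (hg : MemLp g 2 (volume.restrict S)) : Integrable g (volume.restrict S) := by
  have : IsFiniteMeasure (volume.restrict S) := ⟨by simpa using hS.measure_lt_top⟩
  exact hg.integrable (by norm_num)

theorem memLp_of_continuous_of_isCompact (hS : IsCompact S) {g : ℝ → ℂ} (hg : Continuous g) :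
    MemLp g 2 (volume.restrict S) := by
  have : IsFiniteMeasure (volume.restrict S) := ⟨by simpa using hS.measure_lt_top⟩
  obtain ⟨C, hC⟩ := hS.exists_bound_of_continuousOn hg.continuousOn
  exact MemLp.of_bound hg.aestronglyMeasurable C
    ((ae_restrict_iff' hS.measurableSet).2 (Filter.Eventually.of_forall hC))

/-- The `L²` norm of the transform on the real line is the norm of the spectral function. -/
theorem pwNorm_transform (hS : IsCompact S) {g : ℝ → ℂ} (hg : MemLp g 2 (volume.restrict S)) :
    pwNorm (fun z => ∫ t in S, g t * Complex.exp (Complex.I * z * t)) = ‖hg.toLp g‖ := by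
  have h2 : MemLp (S.indicator g) 2 := (memLp_indicator_iff_restrict hS.measurableSet).2 hg
  have h1 : Integrable (S.indicator g) :=
    (integrable_indicator_iff hS.measurableSet).2 (hg.integrable_of_isCompact hS)
  -- `𝓕` uses the character `e^{-2πiξt}`, so `e^{ixt}` corresponds to `ξ = -x/(2π)`; the Jacobian of
  -- this scaling later cancels the factor `(2π)⁻¹` of `pwNorm`.
  have hF : ∀ x : ℝ, ∫ t in S, g t * Complex.exp (Complex.I * (x : ℂ) * t)
      = 𝓕 (S.indicator g) (-(2 * Real.pi)⁻¹ * x) := fun x => by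
    rw [Real.fourier_real_eq_integral_exp_smul, ← integral_indicator hS.measurableSet]
    refine integral_congr_ae (Filter.Eventually.of_forall fun t => ?_)
    by_cases ht : t ∈ S
    · simp only [Set.indicator_of_mem ht, smul_eq_mul]
      rw [mul_comm]
      congr 2
      have : (Real.pi : ℂ) ≠ 0 := by exact_mod_cast Real.pi_ne_zero
      push_cast
      field_simp
    · simp [Set.indicator_of_notMem ht]
  have hnorm : ‖hg.toLp g‖ ^ 2 = ∫ t in S, ‖g t‖ ^ 2 := by
    have := L2.inner_def (𝕜 := ℂ) (hg.toLp g) (hg.toLp g)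
    simp only [inner_self_eq_norm_sq_to_K] at this
    norm_cast at this
    have h3 : ‖hg.toLp g‖ ^ 2 = ∫ t in S, ‖(hg.toLp g) t‖ ^ 2 := by simpa using this
    rw [h3]
    refine integral_congr_ae ?_
    filter_upwards [hg.coeFn_toLp] with x hx
    rw [hx]
  unfold pwNorm
  simp only [hF]
  rw [Measure.integral_comp_mul_left (fun y => ‖𝓕 (S.indicator g) y‖ ^ 2),
    integral_norm_fourier_sq h1 h2, Real.sqrt_eq_iff_mul_self_eq (by positivity) (by positivity),
    ← sq, hnorm, ← integral_indicator hS.measurableSet, smul_eq_mul, ← mul_assoc]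
  have hpi := Real.pi_pos
  have : (2 * Real.pi)⁻¹ * |(-(2 * Real.pi)⁻¹)⁻¹| = 1 := by
    rw [abs_inv, abs_neg, abs_inv, inv_inv, abs_of_pos (by positivity)]
    field_simp
  rw [this, one_mul]
  refine integral_congr_ae (Filter.Eventually.of_forall fun t => ?_)
  by_cases ht : t ∈ S
  · simp [Set.indicator_of_mem ht]
  · simp [Set.indicator_of_notMem ht]

/-- The spectral function of the reproducing kernel at `w`. -/
def expLp (hS : IsCompact S) (w : ℂ) : Lp ℂ 2 (volume.restrict S) :=
  (memLp_of_continuous_of_isCompact hS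
    (g := fun t : ℝ => Complex.exp (-Complex.I * (starRingEnd ℂ) w * t)) (by fun_prop)).toLp _

theorem coeFn_expLp (hS : IsCompact S) (w : ℂ) :
    expLp hS w =ᵐ[volume.restrict S]
      fun t : ℝ => Complex.exp (-Complex.I * (starRingEnd ℂ) w * t) :=
  MemLp.coeFn_toLp _

theorem inner_expLp (hS : IsCompact S) (w : ℂ) (u : Lp ℂ 2 (volume.restrict S)) :
    ⟪expLp hS w, u⟫_ℂ = ∫ t in S, u t * Complex.exp (Complex.I * w * t) := by
  rw [L2.inner_def]
  refine integral_congr_ae ?_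
  filter_upwards [coeFn_expLp hS w] with t ht
  rw [ht, RCLike.inner_apply, ← Complex.exp_conj]
  simp

theorem inner_expLp_toLp (hS : IsCompact S) (w : ℂ) {g : ℝ → ℂ}
    (hg : MemLp g 2 (volume.restrict S)) :
    ⟪expLp hS w, hg.toLp g⟫_ℂ = ∫ t in S, g t * Complex.exp (Complex.I * w * t) := by
  rw [inner_expLp]
  refine integral_congr_ae ?_
  filter_upwards [hg.coeFn_toLp] with t ht
  rw [ht]

theorem pwNorm_pwKernel (hS : IsCompact S) (w : ℂ) : pwNorm (pwKernel S w) = ‖expLp hS w‖ := by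
  rw [expLp, ← pwNorm_transform hS]
  congr 1
  ext z
  refine integral_congr_ae (Filter.Eventually.of_forall fun t => ?_)
  simp only [← Complex.exp_add]
  congr 1
  ring

theorem norm_expLp_sq (hS : IsCompact S) (w : ℂ) :
    ‖expLp hS w‖ ^ 2 = ∫ t in S, Real.exp (-2 * w.im * t) := by
  have h : ((‖expLp hS w‖ ^ 2 : ℝ) : ℂ) = ∫ t in S, (Real.exp (-2 * w.im * t) : ℂ) := by
    have := inner_self_eq_norm_sq_to_K (𝕜 := ℂ) (expLp hS w)
    rw [Complex.ofReal_pow]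
    refine this.symm.trans ?_
    rw [inner_expLp]
    refine integral_congr_ae ?_
    filter_upwards [coeFn_expLp hS w] with t ht
    rw [ht, ← Complex.exp_add, Complex.ofReal_exp]
    congr 1
    apply Complex.ext <;> simp
    ring
  rw [integral_complex_ofReal] at h
  exact_mod_cast h

theorem mem_paleyWiener_iff (hS : IsCompact S) (f : ℂ → ℂ) :
    f ∈ PaleyWiener S ↔ ∃ u : Lp ℂ 2 (volume.restrict S), ∀ z, f z = ⟪expLp hS z, u⟫_ℂ := by
  constructor
  · rintro ⟨g, hg, h⟩
    exact ⟨hg.toLp g, fun z => by rw [h, inner_expLp_toLp]⟩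
  · rintro ⟨u, h⟩
    exact ⟨u, Lp.memLp u, fun z => by rw [h, inner_expLp]⟩

/-- By Plancherel a vanishing transform has a spectral function of norm zero. -/
theorem eq_of_inner_expLp_eq (hS : IsCompact S) {u v : Lp ℂ 2 (volume.restrict S)}
    (h : ∀ z, ⟪expLp hS z, u⟫_ℂ = ⟪expLp hS z, v⟫_ℂ) : u = v := by
  have h1 := pwNorm_transform hS (Lp.memLp (u - v))
  rw [Lp.toLp_coeFn] at h1
  have h2 : (fun z => ∫ t in S, (u - v) t * Complex.exp (Complex.I * z * t)) = fun _ => 0 := by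
    ext z
    rw [← inner_expLp hS z (u - v), inner_sub_right, h, sub_self]
  rw [h2] at h1
  have h3 : ‖u - v‖ = 0 := by
    rw [← h1]
    simp [pwNorm]
  exact sub_eq_zero.1 (norm_eq_zero.1 h3)

/-- The normalized spectral function of the reproducing kernel at `w`. -/
def unitKernel (hS : IsCompact S) (w : ℂ) : Lp ℂ 2 (volume.restrict S) :=
  ((‖expLp hS w‖⁻¹ : ℝ) : ℂ) • expLp hS w

theorem inner_unitKernel (hS : IsCompact S) (w : ℂ) (u : Lp ℂ 2 (volume.restrict S)) :
    ⟪unitKernel hS w, u⟫_ℂ = ⟪expLp hS w, u⟫_ℂ / (‖expLp hS w‖ : ℂ) := by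
  rw [unitKernel, inner_smul_left, Complex.conj_ofReal, Complex.ofReal_inv, div_eq_inv_mul]

theorem isCompleteInterpolating_iff (hS : IsCompact S) (L : Set ℂ) :
    IsCompleteInterpolating S L ↔ IsInterpolatingSystem fun l : L => unitKernel hS (l : ℂ) := by
  refine forall₂_congr fun a _ => ?_
  simp only [inner_unitKernel, pwNorm_pwKernel hS]
  constructor
  · rintro ⟨f, ⟨hf, hfa⟩, huniq⟩
    obtain ⟨u, hu⟩ := (mem_paleyWiener_iff hS f).1 hf
    refine ⟨u, fun l => by rw [← hu, hfa], fun v hv => eq_of_inner_expLp_eq hS fun z => ?_⟩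
    rw [← hu, ← huniq (fun z => ⟪expLp hS z, v⟫_ℂ)
      ⟨(mem_paleyWiener_iff hS _).2 ⟨v, fun _ => rfl⟩, hv⟩]
  · rintro ⟨u, hu, huniq⟩
    refine ⟨fun z => ⟪expLp hS z, u⟫_ℂ, ⟨(mem_paleyWiener_iff hS _).2 ⟨u, fun _ => rfl⟩, hu⟩, ?_⟩
    rintro f ⟨hf, hfa⟩
    obtain ⟨v, hv⟩ := (mem_paleyWiener_iff hS f).1 hf
    ext z
    rw [hv, huniq v fun l => by rw [← hv, hfa]]

end Transform

/-! ### Primitives and division by a linear factor -/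

section Primitive

theorem integral_indicator_Ici_exp {c d r : ℝ} (hr : r ∈ Set.Icc c d) (w : ℂ) :
    w * ∫ s in Set.Icc c d, (Set.Ici r).indicator (fun s : ℝ => Complex.exp (w * s)) s
      = Complex.exp (w * d) - Complex.exp (w * r) := by
  rcases eq_or_ne w 0 with rfl | hw
  · simp
  rw [setIntegral_indicator measurableSet_Ici]
  have : Set.Icc c d ∩ Set.Ici r = Set.Icc r d := by
    ext s
    simp only [Set.mem_inter_iff, Set.mem_Icc, Set.mem_Ici]
    exact ⟨fun h => ⟨h.2, h.1.2⟩, fun h => ⟨⟨hr.1.trans h.1, h.2⟩, h.1⟩⟩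
  rw [this, integral_Icc_eq_integral_Ioc, ← intervalIntegral.integral_of_le hr.2,
    integral_exp_mul_complex hw, mul_div_cancel₀ _ hw]

/-- Integration by parts for the transform of a primitive. -/
theorem mul_integral_primitive_mul_exp {c d : ℝ} {φ : ℝ → ℂ} (hφ : Integrable φ) (w : ℂ) :
    w * ∫ s in Set.Icc c d, (∫ r in c..s, φ r) * Complex.exp (w * s)
      = ∫ r in Set.Icc c d, φ r * (Complex.exp (w * d) - Complex.exp (w * r)) := by
  let μ := volume.restrict (Set.Icc c d)
  have hexp : Integrable (fun s : ℝ => Complex.exp (w * s)) μ :=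
    (memLp_of_continuous_of_isCompact isCompact_Icc (by fun_prop)).integrable_of_isCompact
      isCompact_Icc
  have hK : Integrable (Function.uncurry fun s r : ℝ =>
      φ r * (Set.Ici r).indicator (fun s : ℝ => Complex.exp (w * s)) s) (μ.prod μ) := by
    have h1 : Integrable (fun p : ℝ × ℝ => Complex.exp (w * p.1) * φ p.2) (μ.prod μ) :=
      hexp.mul_prod (hφ.mono_measure Measure.restrict_le_self)
    have h2 : MeasurableSet {p : ℝ × ℝ | p.2 ≤ p.1} := measurableSet_le measurable_snd measurable_fst
    refine (h1.indicator h2).congr (Filter.Eventually.of_forall fun p => ?_)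
    by_cases hp : p.2 ≤ p.1
    · simp [Function.uncurry, hp, mul_comm]
    · simp [Function.uncurry, hp]
  have h1 : ∫ s in Set.Icc c d, (∫ r in c..s, φ r) * Complex.exp (w * s)
      = ∫ s, ∫ r, φ r * (Set.Ici r).indicator (fun s : ℝ => Complex.exp (w * s)) s ∂μ ∂μ := by
    refine setIntegral_congr_fun measurableSet_Icc fun s hs => ?_
    have h3 : ∀ r, φ r * (Set.Ici r).indicator (fun s : ℝ => Complex.exp (w * s)) s
        = (Set.Iic s).indicator φ r * Complex.exp (w * s) := fun r => by
      by_cases hr : r ≤ s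
      · rw [Set.indicator_of_mem (show s ∈ Set.Ici r from hr),
          Set.indicator_of_mem (show r ∈ Set.Iic s from hr)]
      · rw [Set.indicator_of_notMem (show s ∉ Set.Ici r from hr),
          Set.indicator_of_notMem (show r ∉ Set.Iic s from hr)]
        simp
    simp only [h3]
    rw [integral_mul_const, setIntegral_indicator measurableSet_Iic]
    have h4 : Set.Icc c d ∩ Set.Iic s = Set.Icc c s := by
      ext r
      simp only [Set.mem_inter_iff, Set.mem_Icc, Set.mem_Iic]
      exact ⟨fun h => ⟨h.1.1, h.2⟩, fun h => ⟨⟨h.1, h.2.trans hs.2⟩, h.2⟩⟩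
    rw [h4, integral_Icc_eq_integral_Ioc, ← intervalIntegral.integral_of_le hs.1]
  rw [h1, integral_integral_swap hK, ← integral_const_mul]
  refine setIntegral_congr_fun measurableSet_Icc fun r hr => ?_
  rw [integral_const_mul, mul_left_comm, integral_indicator_Ici_exp hr]

/-- Division of a transform by a linear factor: if `∫ v(s) e^{its} ds = 0`, then
`∫ v(s) e^{izs} ds` is `z - t` times the transform of an explicit primitive. -/
theorem sub_mul_transform_primitive {c d : ℝ} {v : ℝ → ℂ} (hv : Integrable v) (t : ℂ)
    (h0 : ∫ s in Set.Icc c d, v s * Complex.exp (Complex.I * t * s) = 0) (z : ℂ) :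
    (z - t) * ∫ s in Set.Icc c d, (-Complex.I * Complex.exp (-(Complex.I * t * s)) *
        ∫ r in c..s, (Set.Icc c d).indicator (fun r => v r * Complex.exp (Complex.I * t * r)) r) *
        Complex.exp (Complex.I * z * s)
      = ∫ s in Set.Icc c d, v s * Complex.exp (Complex.I * z * s) := by
  have hint : ∀ y : ℂ, IntegrableOn (fun r : ℝ => v r * Complex.exp (Complex.I * y * r))
      (Set.Icc c d) := fun y =>
    hv.integrableOn.mul_continuousOn (by fun_prop) isCompact_Icc
  have hφ : Integrable ((Set.Icc c d).indicator
      fun r : ℝ => v r * Complex.exp (Complex.I * t * r)) :=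
    (integrable_indicator_iff measurableSet_Icc).2 (hint t)
  have key := mul_integral_primitive_mul_exp (c := c) (d := d) hφ (Complex.I * (z - t))
  have h1 : ∫ s in Set.Icc c d, (-Complex.I * Complex.exp (-(Complex.I * t * s)) *
        ∫ r in c..s, (Set.Icc c d).indicator (fun r => v r * Complex.exp (Complex.I * t * r)) r) *
        Complex.exp (Complex.I * z * s)
      = -Complex.I * ∫ s in Set.Icc c d,
        (∫ r in c..s, (Set.Icc c d).indicator (fun r => v r * Complex.exp (Complex.I * t * r)) r) *
        Complex.exp (Complex.I * (z - t) * s) := by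
    rw [← integral_const_mul]
    refine setIntegral_congr_fun measurableSet_Icc fun s _ => ?_
    have : Complex.exp (Complex.I * (z - t) * s)
        = Complex.exp (-(Complex.I * t * s)) * Complex.exp (Complex.I * z * s) := by
      rw [← Complex.exp_add]; congr 1; ring
    simp only [this]
    ring
  have h2 : ∫ r in Set.Icc c d, (Set.Icc c d).indicator
        (fun r : ℝ => v r * Complex.exp (Complex.I * t * r)) r *
        (Complex.exp (Complex.I * (z - t) * d) - Complex.exp (Complex.I * (z - t) * r))
      = -∫ s in Set.Icc c d, v s * Complex.exp (Complex.I * z * s) := by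
    have : ∀ r ∈ Set.Icc c d, (Set.Icc c d).indicator
        (fun r : ℝ => v r * Complex.exp (Complex.I * t * r)) r *
        (Complex.exp (Complex.I * (z - t) * d) - Complex.exp (Complex.I * (z - t) * r))
        = Complex.exp (Complex.I * (z - t) * d) * (v r * Complex.exp (Complex.I * t * r))
          - v r * Complex.exp (Complex.I * z * r) := fun r hr => by
      have : Complex.exp (Complex.I * z * r)
          = Complex.exp (Complex.I * t * r) * Complex.exp (Complex.I * (z - t) * r) := by
        rw [← Complex.exp_add]; congr 1; ring
      rw [Set.indicator_of_mem hr, this]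
      ring
    rw [setIntegral_congr_fun measurableSet_Icc this, integral_sub ((hint t).const_mul _) (hint z),
      integral_const_mul, h0, mul_zero, zero_sub]
  rw [h1]
  rw [h2] at key
  linear_combination -key

end Primitive

/-! ### Quotients of `F` by `z - t` -/

section Division

theorem setIntegral_indicator_mul_exp {A B : Set ℝ} (hA : MeasurableSet A) (hAB : A ⊆ B)
    (p : ℝ → ℂ) (z : ℂ) :
    ∫ s in B, A.indicator p s * Complex.exp (Complex.I * z * s)
      = ∫ s in A, p s * Complex.exp (Complex.I * z * s) := by
  have : (fun s : ℝ => A.indicator p s * Complex.exp (Complex.I * z * s))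
      = A.indicator fun s : ℝ => p s * Complex.exp (Complex.I * z * s) := by
    ext s
    by_cases hs : s ∈ A <;> simp [hs]
  rw [this, setIntegral_indicator hA, Set.inter_eq_self_of_subset_right hAB]

/-- A function of `PW_S + z PW_S` in terms of spectral functions based at a point `t`. -/
theorem exists_spectral_of_mem_paleyWienerExt {S B : Set ℝ} (hS : IsCompact S) (hSB : S ⊆ B)
    {F : ℂ → ℂ} (hF : F ∈ PaleyWienerExt S) (t : ℂ) :
    ∃ p q : ℝ → ℂ, MemLp p 2 (volume.restrict S) ∧ MemLp q 2 (volume.restrict S) ∧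
      ∀ z, F z = (∫ s in B, S.indicator p s * Complex.exp (Complex.I * z * s))
        + (z - t) * ∫ s in B, S.indicator q s * Complex.exp (Complex.I * z * s) := by
  obtain ⟨f, ⟨p, hp, hfp⟩, g, ⟨q, hq, hgq⟩, hF⟩ := hF
  -- From `f + z g = (f + t g) + (z - t) g`.
  refine ⟨fun s => p s + t * q s, q, hp.add (hq.const_mul t), hq, fun z => ?_⟩
  have hi : ∀ {r : ℝ → ℂ}, MemLp r 2 (volume.restrict S) →
      IntegrableOn (fun s : ℝ => r s * Complex.exp (Complex.I * z * s)) S := fun hr =>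
    IntegrableOn.mul_continuousOn (hr.integrable_of_isCompact hS) (by fun_prop) hS
  rw [setIntegral_indicator_mul_exp hS.measurableSet hSB,
    setIntegral_indicator_mul_exp hS.measurableSet hSB, hF, hfp, hgq]
  have : ∀ s : ℝ, (p s + t * q s) * Complex.exp (Complex.I * z * s)
      = p s * Complex.exp (Complex.I * z * s) + t * (q s * Complex.exp (Complex.I * z * s)) :=
    fun s => by ring
  simp only [this]
  rw [integral_add (hi hp) ((hi hq).const_mul t), integral_const_mul]
  ring

/-- Division of `F = Fm + Fp` by `z - t` at a zero `t`: the quotient is a transform whose spectral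
function on the gap is a multiple of an exponential. -/
theorem exists_spectral_div_sub {a b c d : ℝ} (hca : c ≤ a) (hab : a < b) (hbd : b ≤ d)
    {Fm Fp : ℂ → ℂ} (hFm : Fm ∈ PaleyWienerExt (Set.Icc c a))
    (hFp : Fp ∈ PaleyWienerExt (Set.Icc b d)) {t : ℂ} (ht : Fm t + Fp t = 0) :
    ∃ u : ℝ → ℂ, MemLp u 2 (volume.restrict (Set.Icc c d)) ∧
      (∀ z, (z - t) * ∫ s in Set.Icc c d, u s * Complex.exp (Complex.I * z * s) = Fm z + Fp z) ∧
      ∀ s ∈ Set.Ioo a b, u s = Complex.I * Fp t * Complex.exp (-Complex.I * t * s) := by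
  have hsubm : Set.Icc c a ⊆ Set.Icc c d := Set.Icc_subset_Icc_right (by linarith)
  have hsubp : Set.Icc b d ⊆ Set.Icc c d := Set.Icc_subset_Icc_left (by linarith)
  obtain ⟨pm, qm, hpm, hqm, hm⟩ :=
    exists_spectral_of_mem_paleyWienerExt isCompact_Icc hsubm hFm t
  obtain ⟨pp, qp, hpp, hqp, hp⟩ :=
    exists_spectral_of_mem_paleyWienerExt isCompact_Icc hsubp hFp t
  have hind : ∀ {A : Set ℝ} {r : ℝ → ℂ}, MeasurableSet A → MemLp r 2 (volume.restrict A) →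
      MemLp (A.indicator r) 2 volume := fun hA hr => (memLp_indicator_iff_restrict hA).2 hr
  have hind1 : ∀ {x y : ℝ} {r : ℝ → ℂ}, MemLp r 2 (volume.restrict (Set.Icc x y)) →
      Integrable ((Set.Icc x y).indicator r) volume := fun hr =>
    (integrable_indicator_iff measurableSet_Icc).2 (hr.integrable_of_isCompact isCompact_Icc)
  set v : ℝ → ℂ := fun s => (Set.Icc c a).indicator pm s + (Set.Icc b d).indicator pp s with hv
  set g : ℝ → ℂ := fun s => (Set.Icc c a).indicator qm s + (Set.Icc b d).indicator qp s with hg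
  have hv1 : Integrable v := (hind1 hpm).add (hind1 hpp)
  have hg2 : MemLp g 2 := (hind measurableSet_Icc hqm).add (hind measurableSet_Icc hqp)
  have hg1 : Integrable g := (hind1 hqm).add (hind1 hqp)
  have hi : ∀ {r : ℝ → ℂ}, Integrable r → ∀ z : ℂ,
      IntegrableOn (fun s : ℝ => r s * Complex.exp (Complex.I * z * s)) (Set.Icc c d) :=
    fun hr z => hr.integrableOn.mul_continuousOn (by fun_prop) isCompact_Icc
  have hF : ∀ z, Fm z + Fp z = (∫ s in Set.Icc c d, v s * Complex.exp (Complex.I * z * s))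
      + (z - t) * ∫ s in Set.Icc c d, g s * Complex.exp (Complex.I * z * s) := fun z => by
    simp only [hv, hg, add_mul]
    rw [hm, hp, integral_add (hi (hind1 hpm) z) (hi (hind1 hpp) z),
      integral_add (hi (hind1 hqm) z) (hi (hind1 hqp) z)]
    ring
  have h0 : ∫ s in Set.Icc c d, v s * Complex.exp (Complex.I * t * s) = 0 := by
    have := hF t
    rw [ht, sub_self, zero_mul, add_zero] at this
    exact this.symm
  set φ : ℝ → ℂ := (Set.Icc c d).indicator fun r => v r * Complex.exp (Complex.I * t * r) with hφ
  have hφ1 : Integrable φ := (integrable_indicator_iff measurableSet_Icc).2 (hi hv1 t)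
  have hcont : Continuous fun s => ∫ r in c..s, φ r :=
    intervalIntegral.continuous_primitive (fun _ _ => hφ1.intervalIntegrable) c
  set W : ℝ → ℂ := fun s => -Complex.I * Complex.exp (-(Complex.I * t * s)) * ∫ r in c..s, φ r
    with hW
  have hWc : Continuous W := by
    have : Continuous fun s : ℝ => -Complex.I * Complex.exp (-(Complex.I * t * s)) := by fun_prop
    exact this.mul hcont
  have hW2 : MemLp W 2 (volume.restrict (Set.Icc c d)) :=
    memLp_of_continuous_of_isCompact isCompact_Icc hWc
  refine ⟨fun s => g s + W s, (hg2.restrict _).add hW2, fun z => ?_, fun s hs => ?_⟩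
  · have hWi : IntegrableOn (fun s : ℝ => W s * Complex.exp (Complex.I * z * s)) (Set.Icc c d) :=
      (Continuous.continuousOn (by fun_prop)).integrableOn_Icc
    simp only [add_mul]
    rw [hF z, integral_add (hi hg1 z) hWi, mul_add, sub_mul_transform_primitive hv1 t h0 z]
    ring
  · have hs1 : s ∉ Set.Icc c a := fun h => absurd h.2 (not_le.2 hs.1)
    have hs2 : s ∉ Set.Icc b d := fun h => absurd h.1 (not_le.2 hs.2)
    -- For `s` in the gap the primitive has collected all of the left interval and none of the right
    -- one, hence the constant `Fm t = -Fp t`.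
    have hΦ : ∫ r in c..s, φ r = Fm t := by
      rw [hm t, sub_self, zero_mul, add_zero, setIntegral_indicator_mul_exp measurableSet_Icc hsubm,
        intervalIntegral.integral_of_le (hca.trans hs.1.le), ← integral_Icc_eq_integral_Ioc]
      have h1 : Set.Icc c a ⊆ Set.Icc c s := Set.Icc_subset_Icc_right hs.1.le
      rw [← setIntegral_indicator_mul_exp measurableSet_Icc h1]
      refine setIntegral_congr_fun measurableSet_Icc fun r hr => ?_
      have hr1 : r ∈ Set.Icc c d := ⟨hr.1, hr.2.trans (hs.2.le.trans hbd)⟩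
      have hr2 : r ∉ Set.Icc b d := fun h => absurd h.1 (not_le.2 (hr.2.trans_lt hs.2))
      simp only [hφ, hv, Set.indicator_of_mem hr1, Set.indicator_of_notMem hr2, add_zero]
    simp only [hg, hW, Set.indicator_of_notMem hs1, Set.indicator_of_notMem hs2, hΦ, zero_add]
    rw [eq_neg_of_add_eq_zero_left ht, show -(Complex.I * t * s) = -Complex.I * t * s by ring]
    ring

/-- If `F(z) = (z - t) G(z)` with `G` a transform, then `F'(t) = G(t)`. -/
theorem deriv_eq_transform {S : Set ℝ} (hS : IsCompact S) {u : ℝ → ℂ}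
    (hu : MemLp u 2 (volume.restrict S)) {F : ℂ → ℂ} {t : ℂ}
    (h : ∀ z, (z - t) * ∫ s in S, u s * Complex.exp (Complex.I * z * s) = F z) :
    deriv F t = ∫ s in S, u s * Complex.exp (Complex.I * t * s) := by
  set G : ℂ → ℂ := fun z => ∫ s in S, u s * Complex.exp (Complex.I * z * s) with hG
  have hu1 := hu.integrable_of_isCompact hS
  obtain ⟨M, hM⟩ := hS.isBounded.exists_norm_le
  have hGc : ContinuousAt G t := by
    refine continuousAt_of_dominated (bound := fun s => ‖u s‖ * Real.exp ((‖t‖ + 1) * M)) ?_ ?_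
      (hu1.norm.mul_const _) ?_
    · exact Filter.Eventually.of_forall fun z =>
        hu1.aestronglyMeasurable.mul (Continuous.aestronglyMeasurable (by fun_prop))
    · filter_upwards [Metric.ball_mem_nhds t one_pos] with z hz
      filter_upwards [ae_restrict_mem hS.measurableSet] with s hs
      rw [norm_mul]
      gcongr
      refine (Complex.norm_exp_le_exp_norm _).trans (Real.exp_le_exp.2 ?_)
      rw [norm_mul, norm_mul, Complex.norm_I, one_mul]
      have h1 : ‖z‖ ≤ ‖t‖ + 1 := by
        have := norm_sub_norm_le z t
        rw [mem_ball_iff_norm] at hz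
        linarith
      have h2 : ‖(s : ℂ)‖ ≤ M := by simpa using hM s hs
      gcongr
    · exact Filter.Eventually.of_forall fun s => by fun_prop
  refine HasDerivAt.deriv ?_
  rw [hasDerivAt_iff_tendsto_slope]
  refine (hGc.tendsto.mono_left nhdsWithin_le_nhds).congr' ?_
  filter_upwards [self_mem_nhdsWithin] with z hz
  have hz' : z - t ≠ 0 := sub_ne_zero.2 hz
  rw [slope_def_field, ← h z, ← h t, sub_self, zero_mul, sub_zero, mul_div_cancel_left₀ _ hz']

end Division

/-! ### Restriction to a smaller spectrum -/

section Restriction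

variable {S B : Set ℝ}

/-- Restriction of square-integrable functions to a smaller set. -/
def restrictL (h : S ⊆ B) : Lp ℂ 2 (volume.restrict B) →L[ℂ] Lp ℂ 2 (volume.restrict S) :=
  LinearMap.mkContinuous
    { toFun := fun u => ((Lp.memLp u).mono_measure (Measure.restrict_mono_set volume h)).toLp u
      map_add' := fun u v => by
        rw [← MemLp.toLp_add]
        exact MemLp.toLp_congr _ _ (ae_mono (Measure.restrict_mono_set volume h) (Lp.coeFn_add u v))
      map_smul' := fun c u => by
        rw [RingHom.id_apply, ← MemLp.toLp_const_smul]
        exact MemLp.toLp_congr _ _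
          (ae_mono (Measure.restrict_mono_set volume h) (Lp.coeFn_smul c u)) }
    1 fun u => by
      have hu : MemLp u 2 (volume.restrict S) :=
        (Lp.memLp u).mono_measure (Measure.restrict_mono_set volume h)
      rw [one_mul, Lp.norm_def u]
      exact (Lp.norm_toLp _ hu).trans_le (ENNReal.toReal_mono (Lp.eLpNorm_ne_top u)
        (eLpNorm_mono_measure _ (Measure.restrict_mono_set volume h)))

theorem coeFn_restrictL (h : S ⊆ B) (u : Lp ℂ 2 (volume.restrict B)) :
    restrictL h u =ᵐ[volume.restrict S] u :=
  ((Lp.memLp u).mono_measure (Measure.restrict_mono_set volume h)).coeFn_toLp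

theorem norm_restrictL_le (h : S ⊆ B) (u : Lp ℂ 2 (volume.restrict B)) :
    ‖restrictL h u‖ ≤ ‖u‖ := by
  have := (restrictL h).le_of_opNorm_le (LinearMap.mkContinuous_norm_le _ zero_le_one _) u
  rwa [one_mul] at this

theorem restrictL_expLp (hS : IsCompact S) (hB : IsCompact B) (h : S ⊆ B) (w : ℂ) :
    restrictL h (expLp hB w) = expLp hS w := by
  refine Lp.ext ?_
  filter_upwards [coeFn_restrictL h (expLp hB w), coeFn_expLp hS w,
    ae_mono (Measure.restrict_mono_set volume h) (coeFn_expLp hB w)] with s h1 h2 h3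
  rw [h1, h2, h3]

theorem norm_expLp_mono (hS : IsCompact S) (hB : IsCompact B) (h : S ⊆ B) (w : ℂ) :
    ‖expLp hS w‖ ≤ ‖expLp hB w‖ := by
  rw [← restrictL_expLp hS hB h]
  exact norm_restrictL_le h _

theorem norm_expLp_Icc_sq {a b : ℝ} (hab : a ≤ b) (w : ℂ) :
    ‖expLp (isCompact_Icc (a := a) (b := b)) w‖ ^ 2 = ∫ s in a..b, Real.exp (-2 * w.im * s) := by
  rw [norm_expLp_sq, integral_Icc_eq_integral_Ioc, ← intervalIntegral.integral_of_le hab]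

theorem norm_expLp_Icc_pos {a b : ℝ} (hab : a < b) (w : ℂ) :
    0 < ‖expLp (isCompact_Icc (a := a) (b := b)) w‖ := by
  have h : 0 < ‖expLp (isCompact_Icc (a := a) (b := b)) w‖ ^ 2 := by
    rw [norm_expLp_Icc_sq hab.le]
    exact intervalIntegral.intervalIntegral_pos_of_pos
      (Continuous.intervalIntegrable (by fun_prop) _ _) (fun s => Real.exp_pos _) hab
  exact (sq_pos_iff.1 h).symm.lt_of_le (norm_nonneg _)

end Restriction

/-! ### Conjugation of the nodes -/

section Reflection

variable {a b : ℝ}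

theorem measurePreserving_reflect_Icc (a b : ℝ) : MeasurePreserving (fun s : ℝ => a + b - s)
    (volume.restrict (Set.Icc a b)) (volume.restrict (Set.Icc a b)) := by
  have h := (Measure.measurePreserving_sub_left (volume : Measure ℝ) (a + b)).restrict_preimage
    (measurableSet_Icc (a := a) (b := b))
  rwa [Set.preimage_const_sub_Icc, add_sub_cancel_left, add_sub_cancel_right] at h

/-- The spectral function of `z ↦ e^{iz(a+b)} conj (f (conj z))`. -/
def reflectLp (u : Lp ℂ 2 (volume.restrict (Set.Icc a b))) :
    Lp ℂ 2 (volume.restrict (Set.Icc a b)) :=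
  ((Lp.memLp u).star.comp_measurePreserving (measurePreserving_reflect_Icc a b)).toLp _

theorem inner_expLp_conj_reflectLp (u : Lp ℂ 2 (volume.restrict (Set.Icc a b))) (w : ℂ) :
    ⟪expLp isCompact_Icc ((starRingEnd ℂ) w), reflectLp u⟫_ℂ =
      Complex.exp (Complex.I * (starRingEnd ℂ) w * (a + b)) *
        (starRingEnd ℂ) ⟪expLp isCompact_Icc w, u⟫_ℂ := by
  rw [reflectLp, inner_expLp_toLp, inner_expLp, ← integral_conj, ← integral_const_mul,
    ← (measurePreserving_reflect_Icc a b).integral_comp'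
      (f := (Homeomorph.subLeft (a + b)).toMeasurableEquiv)]
  refine integral_congr_ae (Filter.Eventually.of_forall fun s => ?_)
  simp only [Function.comp_apply, Homeomorph.toMeasurableEquiv_coe, Homeomorph.subLeft_apply,
    map_mul, ← Complex.exp_conj, Pi.star_apply, Complex.conj_I, Complex.conj_ofReal]
  rw [mul_left_comm, ← Complex.exp_add, starRingEnd_apply, sub_sub_cancel]
  congr 2
  push_cast
  ring

theorem reflectLp_reflectLp (u : Lp ℂ 2 (volume.restrict (Set.Icc a b))) :
    reflectLp (reflectLp u) = u := by
  refine eq_of_inner_expLp_eq isCompact_Icc fun z => ?_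
  have h := inner_expLp_conj_reflectLp (reflectLp u) ((starRingEnd ℂ) z)
  rw [Complex.conj_conj, inner_expLp_conj_reflectLp, map_mul, Complex.conj_conj, ← mul_assoc,
    ← Complex.exp_conj, ← Complex.exp_add] at h
  rw [h]
  simp

theorem norm_expLp_conj (hab : a ≤ b) (w : ℂ) :
    ‖expLp (isCompact_Icc (a := a) (b := b)) ((starRingEnd ℂ) w)‖ =
      ‖Complex.exp (Complex.I * (starRingEnd ℂ) w * (a + b))‖ *
        ‖expLp (isCompact_Icc (a := a) (b := b)) w‖ := by
  rw [← sq_eq_sq₀ (norm_nonneg _) (by positivity), mul_pow, norm_expLp_Icc_sq hab,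
    norm_expLp_Icc_sq hab, Complex.norm_exp, ← Real.exp_nat_mul, ← intervalIntegral.integral_const_mul]
  have h := intervalIntegral.integral_comp_sub_left (a := a) (b := b)
    (fun s => Real.exp (-2 * ((starRingEnd ℂ) w).im * s)) (a + b)
  rw [add_sub_cancel_left, add_sub_cancel_right] at h
  rw [← h]
  refine intervalIntegral.integral_congr fun s _ => ?_
  simp only [← Real.exp_add]
  congr 1
  simp
  ring

/-- Reflection multiplies the value and the kernel norm by factors of equal modulus, so only a phase
survives normalization. -/
theorem exists_inner_unitKernel_conj_reflectLp (hab : a ≤ b) (w : ℂ) :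
    ∃ θ : ℂ, ‖θ‖ = 1 ∧ ∀ u, ⟪unitKernel isCompact_Icc ((starRingEnd ℂ) w), reflectLp u⟫_ℂ =
      θ * (starRingEnd ℂ) ⟪unitKernel (isCompact_Icc (a := a) (b := b)) w, u⟫_ℂ := by
  set e := Complex.exp (Complex.I * (starRingEnd ℂ) w * (a + b)) with he
  have h0 : (‖e‖ : ℂ) ≠ 0 := by
    rw [he]
    exact_mod_cast norm_ne_zero_iff.2 (Complex.exp_ne_zero _)
  refine ⟨e / ‖e‖, ?_, fun u => ?_⟩
  · rw [norm_div, Complex.norm_real, norm_norm, div_self (by exact_mod_cast h0)]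
  · rw [inner_unitKernel, inner_unitKernel, inner_expLp_conj_reflectLp, norm_expLp_conj hab,
      map_div₀, Complex.conj_ofReal, Complex.ofReal_mul, mul_div_mul_comm]

/-- Complete interpolating sequences for an interval are invariant under conjugation. -/
theorem IsInterpolatingSystem.unitKernel_conj (hab : a ≤ b) {T : Set ℂ}
    (h : IsInterpolatingSystem fun t : T => unitKernel (isCompact_Icc (a := a) (b := b)) (t : ℂ)) :
    IsInterpolatingSystem fun t : T =>
      unitKernel (isCompact_Icc (a := a) (b := b)) ((starRingEnd ℂ) (t : ℂ)) := by
  intro c hc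
  choose θ hθ hθu using fun t : T => exists_inner_unitKernel_conj_reflectLp hab (t : ℂ)
  have hθ0 : ∀ t, θ t ≠ 0 := fun t => norm_ne_zero_iff.1 (by rw [hθ]; exact one_ne_zero)
  have hiff : ∀ u (t : T), ⟪unitKernel isCompact_Icc ((starRingEnd ℂ) (t : ℂ)), reflectLp u⟫_ℂ = c t ↔
      ⟪unitKernel (isCompact_Icc (a := a) (b := b)) (t : ℂ), u⟫_ℂ
        = (starRingEnd ℂ) (c t / θ t) := fun u t => by
    rw [hθu, mul_comm, ← eq_div_iff (hθ0 t), ← (RingHom.injective (starRingEnd ℂ)).eq_iff,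
      Complex.conj_conj]
  obtain ⟨u, hu, huniq⟩ := h (fun t => (starRingEnd ℂ) (c t / θ t)) (by simpa [hθ] using hc)
  refine ⟨reflectLp u, fun t => (hiff u t).2 (hu t), fun v hv => ?_⟩
  rw [← huniq (reflectLp v) fun t => (hiff _ t).1 (by rw [reflectLp_reflectLp]; exact hv t),
    reflectLp_reflectLp]

end Reflection

/-! ### The Bessel property on longer intervals -/

section Bessel

variable {a b c d : ℝ}

theorem integral_Icc_comp_add (h : ℝ) (f : ℝ → ℂ) :
    ∫ s in Set.Icc (a + h) (b + h), f s = ∫ s in Set.Icc a b, f (s + h) := by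
  have := ((measurePreserving_add_right volume h).restrict_preimage
    (measurableSet_Icc (a := a + h) (b := b + h))).integral_comp
      (measurableEmbedding_addRight h) f
  rw [← this, Set.preimage_add_const_Icc, add_sub_cancel_right, add_sub_cancel_right]

/-- The factor is the one by which translation changes the transform itself, so normalized values
keep their modulus. -/
theorem norm_expLp_Icc_add (hab : a ≤ b) (h : ℝ) (w : ℂ) :
    ‖expLp (isCompact_Icc (a := a + h) (b := b + h)) w‖ =
      ‖Complex.exp (Complex.I * w * h)‖ * ‖expLp (isCompact_Icc (a := a) (b := b)) w‖ := by
  rw [← sq_eq_sq₀ (norm_nonneg _) (by positivity), mul_pow, norm_expLp_Icc_sq hab,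
    norm_expLp_Icc_sq (by linarith), Complex.norm_exp, ← Real.exp_nat_mul,
    ← intervalIntegral.integral_const_mul,
    ← intervalIntegral.integral_comp_add_right (fun s => Real.exp (-2 * w.im * s)) h]
  refine intervalIntegral.integral_congr fun s _ => ?_
  simp only [← Real.exp_add]
  congr 1
  simp
  ring

variable {T : Set ℂ}

/-- The Bessel property for the interval `[a, b]` passes to its translates inside `[c, d]`. -/
theorem summable_transform_Icc_add (hab : a < b)
    (hT : ∀ x : Lp ℂ 2 (volume.restrict (Set.Icc a b)),
      Summable fun t : T => ‖⟪unitKernel isCompact_Icc (t : ℂ), x⟫_ℂ‖ ^ 2)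
    {h : ℝ} (hc : c ≤ a + h) (hd : b + h ≤ d) {g : ℝ → ℂ} (hg : MemLp g 2) :
    Summable fun t : T => (‖∫ s in Set.Icc (a + h) (b + h),
      g s * Complex.exp (Complex.I * t * s)‖ /
        ‖expLp (isCompact_Icc (a := c) (b := d)) (t : ℂ)‖) ^ 2 := by
  have hgh : MemLp (fun s => g (s + h)) 2 (volume.restrict (Set.Icc a b)) :=
    (hg.comp_measurePreserving (measurePreserving_add_right volume h)).restrict _
  refine Summable.of_nonneg_of_le (fun _ => by positivity) (fun t => ?_) (hT (hgh.toLp _))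
  have h0 := norm_expLp_Icc_pos hab (t : ℂ)
  have he : 0 < ‖Complex.exp (Complex.I * t * h)‖ := norm_pos_iff.2 (Complex.exp_ne_zero _)
  have h1 : ∫ s in Set.Icc (a + h) (b + h), g s * Complex.exp (Complex.I * t * s)
      = Complex.exp (Complex.I * t * h) * ⟪expLp isCompact_Icc (t : ℂ), hgh.toLp _⟫_ℂ := by
    rw [inner_expLp_toLp, integral_Icc_comp_add h, ← integral_const_mul]
    refine integral_congr_ae (Filter.Eventually.of_forall fun s => ?_)
    simp only
    rw [mul_left_comm, ← Complex.exp_add]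
    congr 2
    push_cast
    ring
  have h2 : ‖Complex.exp (Complex.I * t * h)‖ *
      ‖expLp (isCompact_Icc (a := a) (b := b)) (t : ℂ)‖ ≤
        ‖expLp (isCompact_Icc (a := c) (b := d)) (t : ℂ)‖ := by
    rw [← norm_expLp_Icc_add hab.le]
    exact norm_expLp_mono _ _ (Set.Icc_subset_Icc hc hd) _
  rw [h1, inner_unitKernel, norm_div, norm_mul, Complex.norm_real, norm_norm]
  rw [← mul_div_mul_left _ ‖expLp (isCompact_Icc (a := a) (b := b)) (t : ℂ)‖ he.ne']
  have h3 := mul_pos he h0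
  gcongr

theorem Summable.div_sq_of_norm_le_add {ι : Type*} {x y z : ι → ℂ} {n : ι → ℝ}
    (hx : Summable fun i => (‖x i‖ / n i) ^ 2) (hy : Summable fun i => (‖y i‖ / n i) ^ 2)
    (h : ∀ i, z i = x i + y i) : Summable fun i => (‖z i‖ / n i) ^ 2 := by
  refine Summable.of_nonneg_of_le (fun _ => by positivity) (fun i => ?_)
    ((hx.add hy).mul_left 2)
  have h1 : ‖z i‖ ^ 2 ≤ 2 * (‖x i‖ ^ 2 + ‖y i‖ ^ 2) := by
    have h2 : ‖z i‖ ≤ ‖x i‖ + ‖y i‖ := by rw [h]; exact norm_add_le _ _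
    calc ‖z i‖ ^ 2 ≤ (‖x i‖ + ‖y i‖) ^ 2 := by gcongr
      _ ≤ 2 * (‖x i‖ ^ 2 + ‖y i‖ ^ 2) := add_sq_le
  simp only [div_pow]
  rw [← add_div, ← mul_div_assoc]
  gcongr

/-- The Bessel property for an interval passes to any longer interval. -/
theorem summable_inner_unitKernel_of_subinterval (hab : a < b) (hcd : b - a ≤ d - c)
    (hT : ∀ x : Lp ℂ 2 (volume.restrict (Set.Icc a b)),
      Summable fun t : T => ‖⟪unitKernel isCompact_Icc (t : ℂ), x⟫_ℂ‖ ^ 2)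
    (u : Lp ℂ 2 (volume.restrict (Set.Icc c d))) :
    Summable fun t : T => ‖⟪unitKernel isCompact_Icc (t : ℂ), u⟫_ℂ‖ ^ 2 := by
  have hpiece : ∀ x, c ≤ x → x + (b - a) ≤ d → ∀ g : ℝ → ℂ, MemLp g 2 →
      Summable fun t : T => (‖∫ s in Set.Icc x (x + (b - a)),
        g s * Complex.exp (Complex.I * t * s)‖ /
          ‖expLp (isCompact_Icc (a := c) (b := d)) (t : ℂ)‖) ^ 2 := fun x hx hx' g hg => by
    have := summable_transform_Icc_add (c := c) (d := d) (h := x - a) hab hT (by linarith)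
      (by linarith) hg
    rwa [show a + (x - a) = x by ring, show b + (x - a) = x + (b - a) by ring] at this
  -- Induction on the number of translates of `[a, b]` needed to cover `[c, y]`, peeling one off at
  -- the right end.
  have key : ∀ n : ℕ, ∀ y, y ≤ d → y ≤ c + n * (b - a) → ∀ g : ℝ → ℂ, MemLp g 2 →
      Summable fun t : T => (‖∫ s in Set.Icc c y, g s * Complex.exp (Complex.I * t * s)‖ /
        ‖expLp (isCompact_Icc (a := c) (b := d)) (t : ℂ)‖) ^ 2 := by
    intro n
    induction n with
    | zero =>
      intro y _ hy g _
      have h0 : ∀ t : ℂ, ∫ s in Set.Icc c y, g s * Complex.exp (Complex.I * t * s) = 0 := fun t =>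
        by rw [integral_Icc_eq_integral_Ioc, Set.Ioc_eq_empty (by simpa using hy)]; simp
      simp [h0]
    | succ n ih =>
      intro y hyd hy g hg
      rcases le_or_gt c (y - (b - a)) with hcy | hcy
      · have h1 := ih (y - (b - a)) (by linarith) (by push_cast at hy; linarith) g hg
        have h2 := hpiece (y - (b - a)) hcy (by linarith) g hg
        rw [sub_add_cancel] at h2
        refine h1.div_sq_of_norm_le_add h2 fun t => ?_
        have hint : ∀ p q, IntervalIntegrable (fun s : ℝ => g s * Complex.exp (Complex.I * t * s))
            volume p q := fun p q =>
          ((hg.locallyIntegrable (by norm_num)).integrableOn_isCompact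
            isCompact_uIcc).intervalIntegrable.mul_continuousOn
            (by fun_prop)
        simp only [integral_Icc_eq_integral_Ioc]
        rw [← intervalIntegral.integral_of_le hcy, ← intervalIntegral.integral_of_le (by linarith),
          ← intervalIntegral.integral_of_le (by linarith),
          intervalIntegral.integral_add_adjacent_intervals (hint _ _) (hint _ _)]
      -- A remainder shorter than `b - a` is extended by zero to the translate starting at `c`,
      -- which fits in `[c, d]` by `hcd`.
      · have h2 := hpiece c le_rfl (by linarith) ((Set.Icc c y).indicator g)
          (hg.indicator measurableSet_Icc)
        simpa only [setIntegral_indicator_mul_exp measurableSet_Icc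
          (Set.Icc_subset_Icc_right (show y ≤ c + (b - a) by linarith))] using h2
  obtain ⟨n, hn⟩ := exists_nat_ge ((d - c) / (b - a))
  rw [div_le_iff₀ (by linarith)] at hn
  have h1 := key n d le_rfl (by linarith) ((Set.Icc c d).indicator u)
    ((memLp_indicator_iff_restrict measurableSet_Icc).2 (Lp.memLp u))
  simpa only [setIntegral_indicator_mul_exp measurableSet_Icc subset_rfl, inner_expLp,
    inner_unitKernel, norm_div, Complex.norm_real, norm_norm] using h1

end Bessel

/-! ### The spectral gap and the dual vectors -/

section Gap

variable {a b c d : ℝ}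

/-- The transforms of a pair of intervals are those of the hull whose spectral function vanishes
on the gap. -/
theorem mem_paleyWiener_union_iff (hca : c ≤ a) (hab : a < b) (hbd : b ≤ d)
    (hI : Set.Icc a b ⊆ Set.Icc c d) (f : ℂ → ℂ) :
    f ∈ PaleyWiener (Set.Icc c a ∪ Set.Icc b d) ↔
      ∃ u : Lp ℂ 2 (volume.restrict (Set.Icc c d)), restrictL hI u = 0 ∧
        ∀ z, f z = ⟪expLp isCompact_Icc z, u⟫_ℂ := by
  have hE : Set.Icc c a ∪ Set.Icc b d ⊆ Set.Icc c d :=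
    Set.union_subset (Set.Icc_subset_Icc_right (by linarith))
      (Set.Icc_subset_Icc_left (by linarith))
  have hEm : MeasurableSet (Set.Icc c a ∪ Set.Icc b d) := measurableSet_Icc.union measurableSet_Icc
  constructor
  · rintro ⟨g, hg, h⟩
    have hg' : MemLp ((Set.Icc c a ∪ Set.Icc b d).indicator g) 2 (volume.restrict (Set.Icc c d)) :=
      ((memLp_indicator_iff_restrict hEm).2 hg).restrict _
    refine ⟨hg'.toLp _, ?_, fun z => ?_⟩
    · refine Lp.ext ?_
      have h1 : ∀ᵐ s ∂(volume.restrict (Set.Icc a b)), s ∈ Set.Ioo a b := by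
        rw [← Measure.restrict_congr_set (Ioo_ae_eq_Icc (μ := volume) (a := a) (b := b))]
        exact ae_restrict_mem measurableSet_Ioo
      filter_upwards [coeFn_restrictL hI (hg'.toLp _), h1, Lp.coeFn_zero ℂ 2
        (volume.restrict (Set.Icc a b)),
        ae_mono (Measure.restrict_mono_set volume hI) hg'.coeFn_toLp] with s h2 hs h3 h4
      rw [h2, h3, h4, Set.indicator_of_notMem, Pi.zero_apply]
      rintro (hs' | hs')
      · exact absurd hs'.2 (not_le.2 hs.1)
      · exact absurd hs'.1 (not_le.2 hs.2)
    · rw [inner_expLp_toLp, setIntegral_indicator_mul_exp hEm hE, h]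
  · rintro ⟨u, hu, h⟩
    refine ⟨u, (Lp.memLp u).mono_measure (Measure.restrict_mono_set volume hE), fun z => ?_⟩
    rw [h, inner_expLp]
    refine (setIntegral_eq_of_subset_of_ae_sdiff_eq_zero
      (f := fun s : ℝ => u s * Complex.exp (Complex.I * z * s))
      measurableSet_Icc.nullMeasurableSet hE ?_)
    have h1 := coeFn_restrictL hI u
    rw [hu] at h1
    have h2 : ∀ᵐ s ∂(volume.restrict (Set.Icc a b)), u s = 0 := by
      filter_upwards [h1, Lp.coeFn_zero ℂ 2 (volume.restrict (Set.Icc a b))] with s h2 h3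
      rw [← h2, h3, Pi.zero_apply]
    filter_upwards [(ae_restrict_iff' measurableSet_Icc).1 h2] with s hs hs'
    rw [hs, zero_mul]
    have h3 := hs'.2
    rw [Set.mem_union, not_or, Set.mem_Icc, Set.mem_Icc, not_and, not_and] at h3
    exact ⟨(not_le.1 (h3.1 hs'.1.1)).le, not_lt.1 fun h => h3.2 h.le hs'.1.2⟩

/-- The dual vector at a zero `t` of `F = Fm + Fp`, and its restriction to the gap. -/
theorem exists_dual_of_zero (hca : c ≤ a) (hab : a < b) (hbd : b ≤ d)
    (hI : Set.Icc a b ⊆ Set.Icc c d) {F Fm Fp : ℂ → ℂ}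
    (hFm : Fm ∈ PaleyWienerExt (Set.Icc c a)) (hFp : Fp ∈ PaleyWienerExt (Set.Icc b d))
    (hF : ∀ z, F z = Fm z + Fp z) {t : ℂ} (ht : F t = 0) (hF' : deriv F t ≠ 0) :
    ∃ u : Lp ℂ 2 (volume.restrict (Set.Icc c d)),
      ⟪unitKernel isCompact_Icc t, u⟫_ℂ = 1 ∧
      (∀ z, z ≠ t → F z = 0 → ⟪unitKernel isCompact_Icc z, u⟫_ℂ = 0) ∧
      restrictL hI u = (‖expLp (isCompact_Icc (a := c) (b := d)) t‖ / deriv F t *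
        (Complex.I * Fp t) * ‖expLp (isCompact_Icc (a := a) (b := b)) ((starRingEnd ℂ) t)‖ : ℂ) •
          unitKernel isCompact_Icc ((starRingEnd ℂ) t) := by
  obtain ⟨g, hg, hgF, hgI⟩ := exists_spectral_div_sub hca hab hbd hFm hFp ((hF t).symm.trans ht)
  have hgF' : ∀ z, (z - t) * ∫ s in Set.Icc c d, g s * Complex.exp (Complex.I * z * s) = F z :=
    fun z => (hgF z).trans (hF z).symm
  have hd := deriv_eq_transform isCompact_Icc hg hgF'
  have hN : (‖expLp (isCompact_Icc (a := c) (b := d)) t‖ : ℂ) ≠ 0 :=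
    Complex.ofReal_ne_zero.2 (norm_expLp_Icc_pos (by linarith) t).ne'
  have hN' : (‖expLp (isCompact_Icc (a := a) (b := b)) ((starRingEnd ℂ) t)‖ : ℂ) ≠ 0 :=
    Complex.ofReal_ne_zero.2 (norm_expLp_Icc_pos hab _).ne'
  -- Since `F' t` is the value at `t` of the quotient `F(z)/(z - t)`, this multiple has normalized
  -- value `1` at `t`.
  refine ⟨(‖expLp (isCompact_Icc (a := c) (b := d)) t‖ / deriv F t : ℂ) • hg.toLp g,
    ?_, fun z hz hFz => ?_, ?_⟩
  · rw [inner_unitKernel, inner_smul_right, inner_expLp_toLp, ← hd, div_mul_cancel₀ _ hF',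
      div_self hN]
  · have h0 := hgF' z
    rw [hFz] at h0
    rw [inner_unitKernel, inner_smul_right, inner_expLp_toLp,
      (mul_eq_zero.1 h0).resolve_left (sub_ne_zero.2 hz)]
    simp
  · rw [map_smul, unitKernel, mul_assoc, mul_smul, ← mul_smul, ← mul_smul]
    have h1 : restrictL hI (hg.toLp g) =
        (Complex.I * Fp t) • expLp isCompact_Icc ((starRingEnd ℂ) t) := by
      refine Lp.ext ?_
      have h1 : ∀ᵐ s ∂(volume.restrict (Set.Icc a b)), s ∈ Set.Ioo a b := by
        rw [← Measure.restrict_congr_set (Ioo_ae_eq_Icc (μ := volume) (a := a) (b := b))]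
        exact ae_restrict_mem measurableSet_Ioo
      filter_upwards [coeFn_restrictL hI (hg.toLp g), h1, coeFn_expLp isCompact_Icc
        ((starRingEnd ℂ) t), Lp.coeFn_smul (Complex.I * Fp t)
          (expLp (isCompact_Icc (a := a) (b := b)) ((starRingEnd ℂ) t)),
        ae_mono (Measure.restrict_mono_set volume hI) hg.coeFn_toLp] with s h2 hs h3 h4 h5
      rw [h2, h4, Pi.smul_apply, h3, h5, hgI s hs, Complex.conj_conj, smul_eq_mul]
    rw [h1, smul_smul, Complex.ofReal_inv, mul_assoc, mul_assoc, mul_inv_cancel₀ hN', mul_one]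

end Gap

end

/-! ### The main theorem -/

open scoped InnerProductSpace

theorem mainTheorem1 (a b : ℝ) (ha : -Real.pi < a) (hab : a < b) (hb : b < Real.pi)
    (L : Set ℂ) (F Fm Fp : ℂ → ℂ)
    (hF : IsGeneratingFunction (Set.Icc (-Real.pi) a ∪ Set.Icc b Real.pi) L F)
    (hFm : Fm ∈ PaleyWienerExt (Set.Icc (-Real.pi) a))
    (hFp : Fp ∈ PaleyWienerExt (Set.Icc b Real.pi))
    (hdecomp : ∀ z : ℂ, F z = Fm z + Fp z)
    (h1 : IsCompleteInterpolating (Set.Icc (-Real.pi) Real.pi) (L ∪ otherZeros F L))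
    (h2 : IsCompleteInterpolating (Set.Icc a b) (otherZeros F L))
    (h3 : ∃ δ : ℝ, 0 < δ ∧ ∀ t ∈ otherZeros F L,
      δ ≤ ‖Fp t / deriv F t‖ * pwNorm (pwKernel (Set.Icc (-Real.pi) Real.pi) t)
        * pwNorm (pwKernel (Set.Icc a b) ((starRingEnd ℂ) t))) :
    IsCompleteInterpolating (Set.Icc (-Real.pi) a ∪ Set.Icc b Real.pi) L := by
  obtain ⟨δ, hδ, h3⟩ := h3
  have hI : Set.Icc a b ⊆ Set.Icc (-Real.pi) Real.pi := Set.Icc_subset_Icc ha.le hb.le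
  have hEc : IsCompact (Set.Icc (-Real.pi) a ∪ Set.Icc b Real.pi) :=
    isCompact_Icc.union isCompact_Icc
  have hE : Set.Icc (-Real.pi) a ∪ Set.Icc b Real.pi ⊆ Set.Icc (-Real.pi) Real.pi :=
    Set.union_subset (Set.Icc_subset_Icc_right (by linarith))
      (Set.Icc_subset_Icc_left (by linarith))
  rw [isCompleteInterpolating_iff isCompact_Icc] at h1 h2
  have hκ := h2.unitKernel_conj hab.le
  -- Division by zero gives `0`, so the lower bound in (iii) already forces the zeros in `T` to be
  -- simple.
  have hF' : ∀ t ∈ otherZeros F L, deriv F t ≠ 0 := fun t ht h => by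
    have := h3 t ht
    rw [h, div_zero, norm_zero, zero_mul, zero_mul] at this
    linarith
  have hdisj : ∀ l ∈ L, ∀ t ∈ otherZeros F L, l ≠ t := fun l hl t ht h => ht.2 (h ▸ hl)
  have hsum : IsInterpolatingSystem (Sum.elim
      (fun l : L => unitKernel (isCompact_Icc (a := -Real.pi) (b := Real.pi)) (l : ℂ))
      (fun t : otherZeros F L => unitKernel isCompact_Icc (t : ℂ))) := by
    classical
    have hd : Disjoint L (otherZeros F L) := Set.disjoint_left.2 fun z hz ht => ht.2 hz
    let e := Equiv.Set.union hd
    intro c hc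
    obtain ⟨u, hu, huniq⟩ := h1 (c ∘ e) ((e.summable_iff (f := fun i => ‖c i‖ ^ 2)).2 hc)
    have hiff : ∀ v : Lp ℂ 2 (volume.restrict (Set.Icc (-Real.pi) Real.pi)),
        (∀ i : ↥(L ∪ otherZeros F L), ⟪unitKernel isCompact_Icc (i : ℂ), v⟫_ℂ = (c ∘ e) i) ↔
        ∀ i, ⟪Sum.elim
          (fun l : L => unitKernel (isCompact_Icc (a := -Real.pi) (b := Real.pi)) (l : ℂ))
          (fun t : otherZeros F L => unitKernel isCompact_Icc (t : ℂ)) i, v⟫_ℂ = c i := by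
      intro v
      rw [← e.symm.forall_congr_right]
      refine forall_congr' fun i => ?_
      rw [Function.comp_apply, e.apply_symm_apply]
      rcases i with l | t <;> simp [e]
    exact ⟨u, (hiff u).1 hu, fun v hv => huniq v ((hiff v).2 hv)⟩
  have hmain := existsUnique_ker_of_dual_system hsum hκ (restrictL hI)
    (fun t : otherZeros F L =>
      (‖expLp (isCompact_Icc (a := -Real.pi) (b := Real.pi)) (t : ℂ)‖ / deriv F t *
        (Complex.I * Fp t) *
        ‖expLp (isCompact_Icc (a := a) (b := b)) ((starRingEnd ℂ) (t : ℂ))‖ : ℂ)) hδ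
    (fun t => by
      refine (h3 t t.2).trans_eq ?_
      rw [pwNorm_pwKernel isCompact_Icc, pwNorm_pwKernel isCompact_Icc]
      simp only [norm_mul, norm_div, Complex.norm_real, norm_norm, Complex.norm_I]
      ring)
    (fun t => by
      obtain ⟨u, hu1, hu2, hu3⟩ := exists_dual_of_zero ha.le hab hb.le hI hFm hFp hdecomp t.2.1
        (hF' t t.2)
      refine ⟨u, fun l => hu2 l (hdisj l l.2 t t.2) (hF.2 l l.2), fun s => ?_, hu3⟩
      split_ifs with h
      · rw [h, hu1]
      · exact hu2 s (fun h' => h (Subtype.ext h')) s.2.1)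
    (fun hB u => by
      refine summable_inner_unitKernel_of_subinterval hab (by linarith) (fun x => ?_) u
      refine (hB (reflectLp x)).congr fun t => ?_
      obtain ⟨θ, hθ, h⟩ := exists_inner_unitKernel_conj_reflectLp hab.le (t : ℂ)
      rw [h, norm_mul, hθ, one_mul, RCLike.norm_conj])
  intro c hc
  have hNpos : ∀ l : ℂ, 0 < ‖expLp (isCompact_Icc (a := -Real.pi) (b := Real.pi)) l‖ := fun l =>
    norm_expLp_Icc_pos (by linarith) l
  have hNEpos : ∀ l : ℂ, 0 < ‖expLp hEc l‖ := fun l =>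
    (norm_expLp_Icc_pos hb l).trans_le (norm_expLp_mono _ _ Set.subset_union_right l)
  have hNle : ∀ l : ℂ, ‖expLp hEc l‖ ≤ ‖expLp (isCompact_Icc (a := -Real.pi) (b := Real.pi)) l‖ :=
    fun l => norm_expLp_mono _ _ hE l
  -- Passing from the normalization in `PW_E` to that in `PW_π` multiplies the data by a ratio of
  -- kernel norms at most `1`, so they stay square-summable.
  have hiff : ∀ (l : L) (w : ℂ), w / ((pwNorm (pwKernel _ (l : ℂ)) : ℝ) : ℂ) = c l ↔
      w / (‖expLp (isCompact_Icc (a := -Real.pi) (b := Real.pi)) (l : ℂ)‖ : ℂ) =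
        c l * (‖expLp hEc (l : ℂ)‖ /
          ‖expLp (isCompact_Icc (a := -Real.pi) (b := Real.pi)) (l : ℂ)‖) := fun l w => by
    have hN1 := Complex.ofReal_ne_zero.2 (hNpos l).ne'
    have hN2 := Complex.ofReal_ne_zero.2 (hNEpos l).ne'
    rw [pwNorm_pwKernel hEc, div_eq_iff hN2, ← mul_div_assoc, div_left_inj' hN1]
  obtain ⟨u, ⟨hu0, hu⟩, huniq⟩ := hmain (fun l => c l * (‖expLp hEc (l : ℂ)‖ /
      ‖expLp (isCompact_Icc (a := -Real.pi) (b := Real.pi)) (l : ℂ)‖)) <| by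
    refine Summable.of_nonneg_of_le (fun _ => by positivity) (fun l => ?_) hc
    gcongr
    rw [norm_mul, norm_div, Complex.norm_real, Complex.norm_real, norm_norm, norm_norm]
    exact mul_le_of_le_one_right (norm_nonneg _) ((div_le_one (hNpos l)).2 (hNle l))
  refine ⟨fun z => ⟪expLp isCompact_Icc z, u⟫_ℂ,
    ⟨(mem_paleyWiener_union_iff ha.le hab hb.le hI _).2 ⟨u, hu0, fun _ => rfl⟩, fun l => ?_⟩, ?_⟩
  · rw [hiff, ← inner_unitKernel]
    exact hu l
  · rintro f ⟨hf, hfc⟩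
    obtain ⟨v, hv0, hv⟩ := (mem_paleyWiener_union_iff ha.le hab hb.le hI f).1 hf
    ext z
    rw [hv, huniq v ⟨hv0, fun l => ?_⟩]
    rw [inner_unitKernel, ← hv, ← hiff, hfc]
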